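/- Let $k$ be a field of characteristic $0$ and $\beta\in k$ (for instance $k=\mathbb{C}(\beta)$ with $\beta$ an indeterminate), and let $\Lambda$ be the $k$-algebra of symmetric functions in $x_1,x_2,\dots$, with complete symmetric functions $h_n(x)$ ($h_0=1$, and $h_n=0$ for $n<0$) and power sums $p_n(x)=\sum_i x_i^n$. Let $\mathcal F$ be the fermionic Fock space, that is, the infinite wedge space with basis the vectors $v_{i_1}\wedge v_{i_2}\wedge\cdots$, where $i_1>i_2>\cdots$ are integers and, for some $m\in\mathbb Z$, $i_n=m-n$ for all large $n$; scalars are extended to $\Lambda$. The free fermions act by $$\psi_j(v_{i_1}\wedge v_{i_2}\wedge\cdots)=v_j\wedge v_{i_1}\wedge v_{i_2}\wedge\cdots,\qquad \psi_j^*(v_{i_1}\wedge v_{i_2}\wedge\cdots)=\sum_{n\ge 1}(-1)^{n-1}\delta_{j,i_n}\,v_{i_1}\wedge\cdots\wedge\widehat{v_{i_n}}\wedge\cdots .$$ Put $|0\rangle=v_{-1}\wedge v_{-2}\wedge\cdots$ and $|-r\rangle=\psi^*_{-r}\cdots\psi^*_{-2}\psi^*_{-1}|0\rangle$ for $r\ge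 0$, and let $\langle 0|v\rangle$ be the coefficient of $|0\rangle$ in $v$. For $n\ge 1$ put $a_n=\sum_{i\in\mathbb Z}\psi_i\psi^*_{i+n}$, and let $$H(x)=\sum_{n\ge 1}\frac{p_n(x)}{n}\,a_n,\qquad \theta=\beta a_1-\frac{\beta^2}{2}a_2+\frac{\beta^3}{3}a_3-\cdots .$$ For a partition $\lambda=(\lambda_1\ge\dots\ge\lambda_\ell>0)$, padded by $\lambda_i=0$ for $i>\ell$, the dual stable Grothendieck polynomial is $$g_\lambda(x)=\langle 0|\,e^{H(x)}\,\psi_{\lambda_1-1}e^{-\theta}\,\psi_{\lambda_2-2}e^{-\theta}\cdots\psi_{\lambda_s-s}e^{-\theta}\,|-s\rangle\in\Lambda ,$$ where $s\ge\ell$ is any integer, on whose choice the right-hand side does not depend. Then for every $r\ge\ell$ (and every choice of $s\ge\ell$ in the definition of $g_\lambda$) $$g_\lambda(x)=\det\left(\sum_{m\ge 0}\binom{1-i}{m}\beta^m\,h_{\lambda_i-i+j-m}(x)\right)_{1\le i,j\le r}.$$ -/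

import Mathlib

/-! ## Symmetric functions in the variables `x₁, x₂, …`

The variables are indexed by `ℕ`, so `x_{i+1}` is the variable with index `i`. -/

/-- The `k`-algebra `Λ` of symmetric functions: the formal power series in countably many
variables that have bounded degree and are invariant under all permutations of the variables. -/
noncomputable def symmetricFunctions (k : Type*) [Field k] :
    Subalgebra k (MvPowerSeries ℕ k) where
  carrier := {f | (∃ N : ℕ, ∀ d : ℕ →₀ ℕ, N < d.degree → MvPowerSeries.coeff d f = 0) ∧
    ∀ (σ : Equiv.Perm ℕ) (d : ℕ →₀ ℕ),
      MvPowerSeries.coeff (Finsupp.domCongr σ d) f = MvPowerSeries.coeff d f}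
  mul_mem' := by
    rintro f g ⟨⟨N, hN⟩, hf⟩ ⟨⟨M, hM⟩, hg⟩
    refine ⟨⟨N + M, fun d hd => ?_⟩, fun σ d => ?_⟩
    · rw [MvPowerSeries.coeff_mul]
      refine Finset.sum_eq_zero fun p hp => ?_
      rw [Finset.HasAntidiagonal.mem_antidiagonal] at hp
      have h : p.1.degree + p.2.degree = d.degree := by rw [← hp, map_add]
      by_cases h1 : N < p.1.degree
      · rw [hN _ h1, zero_mul]
      · rw [hM p.2 (by omega), mul_zero]
    · rw [MvPowerSeries.coeff_mul, MvPowerSeries.coeff_mul]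
      symm
      refine Finset.sum_equiv
        ((Finsupp.domCongr σ).toEquiv.prodCongr (Finsupp.domCongr σ).toEquiv) ?_ ?_
      · intro p
        simp only [Finset.HasAntidiagonal.mem_antidiagonal, Equiv.prodCongr_apply, Prod.map,
          AddEquiv.toEquiv_eq_coe, AddEquiv.coe_toEquiv]
        rw [← map_add, EmbeddingLike.apply_eq_iff_eq]
      · intro p _
        exact (congrArg₂ (· * ·) (hf σ p.1) (hg σ p.2)).symm
  add_mem' := by
    rintro f g ⟨⟨N, hN⟩, hf⟩ ⟨⟨M, hM⟩, hg⟩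
    refine ⟨⟨N + M, fun d hd => ?_⟩, fun σ d => ?_⟩
    · rw [map_add, hN d (by omega), hM d (by omega), add_zero]
    · rw [map_add, map_add, hf, hg]
  algebraMap_mem' := by
    classical
    intro c
    refine ⟨⟨0, fun d hd => ?_⟩, fun σ d => ?_⟩
    · have : d ≠ 0 := by rintro rfl; simp at hd
      rw [MvPowerSeries.algebraMap_apply, MvPowerSeries.coeff_C, if_neg this]
    · simp only [MvPowerSeries.algebraMap_apply, MvPowerSeries.coeff_C,
        EmbeddingLike.map_eq_zero_iff]

/-- The ring `Λ`, as a type. -/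
def SymFun (k : Type*) [Field k] : Type _ := symmetricFunctions k

noncomputable instance SymFun.instCommRing (k : Type*) [Field k] : CommRing (SymFun k) :=
  inferInstanceAs (CommRing (symmetricFunctions k))

noncomputable instance SymFun.instAlgebra (k : Type*) [Field k] : Algebra k (SymFun k) :=
  inferInstanceAs (Algebra k (symmetricFunctions k))

theorem degree_domCongr (σ : Equiv.Perm ℕ) (d : ℕ →₀ ℕ) :
    (Finsupp.domCongr σ d).degree = d.degree := by
  rw [Finsupp.domCongr_apply, Finsupp.equivMapDomain_eq_mapDomain, Finsupp.degree_mapDomain]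

open Classical in
/-- The complete symmetric function `h_n`, the sum of all monomials of degree `n`; in particular
`h_0 = 1` and `h_n = 0` for `n < 0`. -/
noncomputable def completeSymm (k : Type*) [Field k] (n : ℤ) : SymFun k :=
  (⟨fun d => if (d.degree : ℤ) = n then 1 else 0, by
    refine ⟨⟨n.toNat, fun d hd => ?_⟩, fun σ d => ?_⟩
    · exact if_neg (by omega)
    · change (if ((Finsupp.domCongr σ d).degree : ℤ) = n then (1 : k) else 0) = _
      rw [degree_domCongr]
      rfl⟩ : symmetricFunctions k)

open Classical in
/-- The power sum `p_n = x₁ⁿ + x₂ⁿ + ⋯`, for `n ≥ 1`. -/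
noncomputable def powerSum (k : Type*) [Field k] (n : ℕ) : SymFun k :=
  (⟨fun d => if ∃ i, d = Finsupp.single i n then 1 else 0, by
    refine ⟨⟨n, fun d hd => ?_⟩, fun σ d => ?_⟩
    · refine if_neg ?_
      rintro ⟨i, rfl⟩
      simp at hd
    · refine if_congr ⟨?_, ?_⟩ rfl rfl
      · rintro ⟨i, hi⟩
        refine ⟨σ.symm i, (Finsupp.domCongr σ).injective ?_⟩
        rw [hi]
        simp
      · rintro ⟨i, rfl⟩
        exact ⟨σ i, by simp⟩⟩ : symmetricFunctions k)

/-! ## Free fermions acting on the infinite wedge space -/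

/-- The index set of the standard basis of the infinite wedge space: `S` stands for
`v_{i₁} ∧ v_{i₂} ∧ ⋯` with `i₁ > i₂ > ⋯` and `S = {i₁, i₂, …}`. The condition says that
`i_n = m - n` for some integer `m` and all large `n`. -/
def Maya : Type :=
  {S : Set ℤ // {j | j ∈ S ∧ 0 ≤ j}.Finite ∧ {j | j ∉ S ∧ j < 0}.Finite}

/-- The basis index of `v_{-1} ∧ v_{-2} ∧ v_{-3} ∧ ⋯`. -/
def Maya.vacuum : Maya :=
  ⟨{j | j < 0}, by
    constructor
    · convert Set.finite_empty
      ext j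
      simp
    · convert Set.finite_empty
      ext j
      simp⟩

/-- Add `j` to the index set. -/
def Maya.insert (S : Maya) (j : ℤ) : Maya :=
  ⟨Insert.insert j S.1, by
    constructor
    · refine (S.2.1.insert j).subset ?_
      rintro i ⟨hi | hi, h0⟩
      · exact Or.inl hi
      · exact Or.inr ⟨hi, h0⟩
    · refine S.2.2.subset ?_
      rintro i ⟨hi, h0⟩
      exact ⟨fun h => hi (Or.inr h), h0⟩⟩

/-- Remove `j` from the index set. -/
def Maya.erase (S : Maya) (j : ℤ) : Maya :=
  ⟨S.1 \ {j}, by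
    constructor
    · refine S.2.1.subset ?_
      rintro i ⟨hi, h0⟩
      exact ⟨hi.1, h0⟩
    · refine (S.2.2.insert j).subset ?_
      rintro i ⟨hi, h0⟩
      by_cases h : i = j
      · exact Or.inl h
      · exact Or.inr ⟨fun h' => hi ⟨h', h⟩, h0⟩⟩

/-- The number of elements of `S` that are larger than `j` (a finite number). -/
noncomputable def Maya.above (S : Maya) (j : ℤ) : ℕ := {i | i ∈ S.1 ∧ j < i}.ncard

/-- The fermionic Fock space with coefficients in `R`. -/
abbrev FockSpace (R : Type*) [CommRing R] := Maya →₀ R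

open Classical in
/-- The free fermion `ψ_j`: `v_{i₁} ∧ v_{i₂} ∧ ⋯ ↦ v_j ∧ v_{i₁} ∧ v_{i₂} ∧ ⋯`. -/
noncomputable def psi (R : Type*) [CommRing R] (j : ℤ) : Module.End R (FockSpace R) :=
  Finsupp.linearCombination R fun S : Maya =>
    if j ∈ S.1 then 0 else Finsupp.single (S.insert j) ((-1 : R) ^ S.above j)

open Classical in
/-- The free fermion `ψ_j^*`: the contraction with the dual basis vector of `v_j`, that is
`v_{i₁} ∧ v_{i₂} ∧ ⋯ ↦ (-1)^{n-1} v_{i₁} ∧ ⋯ (omit v_{i_n}) ⋯` if `i_n = j`, and `0` if `j` does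
not occur. -/
noncomputable def psiStar (R : Type*) [CommRing R] (j : ℤ) : Module.End R (FockSpace R) :=
  Finsupp.linearCombination R fun S : Maya =>
    if j ∈ S.1 then Finsupp.single (S.erase j) ((-1 : R) ^ S.above j) else 0

/-- The vector `|-r⟩ = ψ^*_{-r} ⋯ ψ^*_{-2} ψ^*_{-1} |0⟩`. -/
noncomputable def ketNeg (R : Type*) [CommRing R] : ℕ → FockSpace R
  | 0 => Finsupp.single Maya.vacuum 1
  | r + 1 => psiStar R (-((r : ℤ) + 1)) (ketNeg R r)

/-- The linear form `v ↦ ⟨0|v⟩`, for the form in which the standard basis is orthonormal. -/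
noncomputable def braVacuum (R : Type*) [CommRing R] : FockSpace R →ₗ[R] R :=
  Finsupp.lapply Maya.vacuum

/-- The operator `a_n = ∑_{i ∈ ℤ} ψ_i ψ^*_{i+n}` for `n ≥ 1`, where normal ordering plays no role.
Only finitely many terms are nonzero on a basis vector. -/
noncomputable def current (R : Type*) [CommRing R] (n : ℕ) : Module.End R (FockSpace R) :=
  Finsupp.linearCombination R fun S : Maya =>
    ∑ᶠ i : ℤ, psi R i (psiStar R (i + n) (Finsupp.single S 1))

/-- The operator `∑_{n ≥ 1} c_n a_n`. Only finitely many terms are nonzero on a basis vector. -/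
noncomputable def currentSum {R : Type*} [CommRing R] (c : ℕ → R) :
    Module.End R (FockSpace R) :=
  Finsupp.linearCombination R fun S : Maya =>
    ∑ᶠ n : ℕ, c (n + 1) • current R (n + 1) (Finsupp.single S 1)

/-- The exponential `e^X = ∑_{n ≥ 0} X^n / n!` of a locally nilpotent operator `X`; every operator
`∑_{n ≥ 1} c_n a_n` is locally nilpotent. -/
noncomputable def expOp (k : Type*) [Field k] {R : Type*} [CommRing R] [Algebra k R]
    (X : Module.End R (FockSpace R)) : Module.End R (FockSpace R) :=
  Finsupp.linearCombination R fun S : Maya =>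
    ∑ᶠ n : ℕ, ((n.factorial : k)⁻¹) • (X ^ n) (Finsupp.single S 1)

/-- `H(x) = ∑_{n ≥ 1} (p_n(x) / n) a_n`. -/
noncomputable def opH (k : Type*) [Field k] :
    Module.End (SymFun k) (FockSpace (SymFun k)) :=
  currentSum fun n => (n : k)⁻¹ • powerSum k n

/-- `θ = β a_1 - (β² / 2) a_2 + (β³ / 3) a_3 - ⋯`. -/
noncomputable def opTheta {k : Type*} [Field k] (β : k) :
    Module.End (SymFun k) (FockSpace (SymFun k)) :=
  currentSum fun n => algebraMap k (SymFun k) ((-1) ^ (n - 1) * β ^ n / n)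

/-- The dual stable Grothendieck polynomial
`g_lam(x) = ⟨0| e^{H(x)} ψ_{lam_1 - 1} e^{-θ} ψ_{lam_2 - 2} e^{-θ} ⋯ ψ_{lam_s - s} e^{-θ} |-s⟩`,
written with `s` factors, where `s` is at least the length of the partition `lam`
(which is padded with zeros); `lam_{i+1}` is `lam.rowLen i`. -/
noncomputable def dualGrothendieck {k : Type*} [Field k] (β : k) (lam : YoungDiagram) (s : ℕ) :
    SymFun k :=
  braVacuum (SymFun k)
    (expOp k (opH k)
      ((List.ofFn fun i : Fin s =>
          psi (SymFun k) ((lam.rowLen i : ℤ) - ((i : ℤ) + 1)) *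
            expOp k (-opTheta β)).prod
        (ketNeg (SymFun k) s)))

/-! ## Locally finite sums of operators -/

/-! Write `psiSeries j f` for ∑ fₙ ψ_{j-n}. Since [a_n, ψ_j] = ψ_{j-n}, the commutator with X = ∑ cₙ
aₙ multiplies the symbol f by the series ∑ cₙ tⁿ. Hence e^X carries `psiSeries j f` past itself to
`psiSeries j (F * f)`, where F = exp(∑ cₙ tⁿ) (`expOp_psiSeries`). For H(x), Newton's identity makes
F the generating series of the h_n; for -θ the series is G = (1 + βt)⁻¹.

All currents kill |-s⟩, so every exponential can be moved right and absorbed. In zero-based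
numbering, factor i has e^H and i copies of e^{-θ} to its left, and its symbol becomes F Gⁱ. The
vacuum coefficient of such a product of fields is a determinant of coefficients of the symbols:
contracting with one ψ* at a time is Laplace expansion along the first column (`wick_contraction`,
`prod_psiSeries_apply_lowered`). The binomial series of Gⁱ gives the stated entries.

This yields the s × s determinant. Rows beyond the length of the partition are upper unitriangular,
so the size can be changed to r (`det_eq_of_unitriangular_rows`).

All infinite sums are finite on each vector; F enters only through F' = (∑ cₙ tⁿ)' F and F(0) = 1.
-/

theorem linearCombination_finsum_apply {R ι σ : Type*} [CommRing R]
    (T : ι → Module.End R (σ →₀ R)) (hT : ∀ v, (Function.support fun i => T i v).Finite)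
    (v : σ →₀ R) :
    Finsupp.linearCombination R (fun S => ∑ᶠ i, T i (Finsupp.single S 1)) v = ∑ᶠ i, T i v := by
  induction v using Finsupp.induction_linear with
  | zero => simp
  | add v w hv hw =>
    simp only [map_add, hv, hw]
    exact (finsum_add_distrib (hT v) (hT w)).symm
  | single S r =>
    rw [Finsupp.linearCombination_single, smul_finsum' r (hT _)]
    refine finsum_congr fun i => ?_
    rw [← map_smul, Finsupp.smul_single, smul_eq_mul, mul_one]

/-! ## The index sets -/

namespace Maya

@[ext] theorem ext {S T : Maya} (h : ∀ i, i ∈ S.1 ↔ i ∈ T.1) : S = T :=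
  Subtype.ext (Set.ext h)

@[simp] theorem mem_insert {S : Maya} {i j : ℤ} : i ∈ (S.insert j).1 ↔ i = j ∨ i ∈ S.1 := Iff.rfl

@[simp] theorem mem_erase {S : Maya} {i j : ℤ} : i ∈ (S.erase j).1 ↔ i ∈ S.1 ∧ i ≠ j := Iff.rfl

theorem exists_bound (S : Maya) : ∃ N : ℕ, (∀ i ∈ S.1, i ≤ N) ∧ ∀ i, i < -(N : ℤ) → i ∈ S.1 := by
  obtain ⟨a, ha⟩ := S.2.1.bddAbove
  obtain ⟨b, hb⟩ := S.2.2.bddBelow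
  refine ⟨a.toNat + b.natAbs, fun i hi => ?_, fun i hi => ?_⟩
  · by_cases h : 0 ≤ i
    · have := ha ⟨hi, h⟩
      omega
    · omega
  · by_contra h
    have := hb ⟨h, by omega⟩
    omega

theorem finite_above (S : Maya) (j : ℤ) : {i | i ∈ S.1 ∧ j < i}.Finite := by
  obtain ⟨N, h, -⟩ := S.exists_bound
  exact (Set.finite_Ioc j N).subset fun i hi => ⟨hi.2, h i hi.1⟩

theorem above_insert_of_lt {S : Maya} {i j : ℤ} (hi : i ∉ S.1) (h : j < i) :
    (S.insert i).above j = S.above j + 1 := by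
  unfold above
  rw [← Set.ncard_insert_of_notMem (a := i) (fun h => hi h.1) (S.finite_above j)]
  congr 1
  ext l
  simp only [mem_insert, Set.mem_ofPred_eq, Set.mem_insert_iff]
  grind

theorem above_insert_of_le {S : Maya} {i j : ℤ} (h : i ≤ j) :
    (S.insert i).above j = S.above j := by
  unfold above
  congr 1
  ext l
  simp only [mem_insert, Set.mem_ofPred_eq]
  grind

theorem above_erase_of_lt {S : Maya} {i j : ℤ} (hi : i ∈ S.1) (h : j < i) :
    (S.erase i).above j + 1 = S.above j := by
  rw [← above_insert_of_lt (S := S.erase i) (fun h => h.2 rfl) h]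
  congr 1
  ext l
  simp only [mem_insert, mem_erase]
  grind

theorem above_erase_of_le {S : Maya} {i j : ℤ} (h : i ≤ j) :
    (S.erase i).above j = S.above j := by
  unfold above
  congr 1
  ext l
  simp only [mem_erase, Set.mem_ofPred_eq]
  grind

end Maya

/-! ## Canonical anticommutation relations -/

section Fermions

variable {R : Type*} [CommRing R]

theorem psi_single_of_mem {S : Maya} {j : ℤ} (h : j ∈ S.1) (r : R) :
    psi R j (Finsupp.single S r) = 0 := by
  simp [psi, h]

theorem psi_single_of_notMem {S : Maya} {j : ℤ} (h : j ∉ S.1) (r : R) :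
    psi R j (Finsupp.single S r) = Finsupp.single (S.insert j) ((-1) ^ S.above j * r) := by
  simp [psi, h, mul_comm]

theorem psiStar_single_of_mem {S : Maya} {j : ℤ} (h : j ∈ S.1) (r : R) :
    psiStar R j (Finsupp.single S r) = Finsupp.single (S.erase j) ((-1) ^ S.above j * r) := by
  simp [psiStar, h, mul_comm]

theorem psiStar_single_of_notMem {S : Maya} {j : ℤ} (h : j ∉ S.1) (r : R) :
    psiStar R j (Finsupp.single S r) = 0 := by
  simp [psiStar, h]

theorem psi_psi (i j : ℤ) (v : FockSpace R) : psi R i (psi R j v) = -psi R j (psi R i v) := by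
  induction v using Finsupp.induction_linear with
  | zero => simp
  | add v w hv hw => simp only [map_add, hv, hw, neg_add]
  | single S r =>
    wlog hij : i ≤ j generalizing i j
    · rw [this j i (by omega), neg_neg]
    rcases hij.eq_or_lt with rfl | hij
    · by_cases h : i ∈ S.1
      · simp [psi_single_of_mem h]
      · rw [psi_single_of_notMem h, psi_single_of_mem (S := S.insert i) (Or.inl rfl), neg_zero]
    by_cases hi : i ∈ S.1
    · by_cases hj : j ∈ S.1
      · simp [psi_single_of_mem hi, psi_single_of_mem hj]
      · rw [psi_single_of_mem hi, psi_single_of_notMem hj,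
          psi_single_of_mem (S := S.insert j) (Or.inr hi), map_zero, neg_zero]
    by_cases hj : j ∈ S.1
    · rw [psi_single_of_mem hj, psi_single_of_notMem hi,
        psi_single_of_mem (S := S.insert i) (Or.inr hj), map_zero, neg_zero]
    -- As i < j, inserting j raises the count above i by one, while inserting i leaves the count
    -- above j unchanged: this is the sign.
    rw [psi_single_of_notMem hi, psi_single_of_notMem hj,
      psi_single_of_notMem (S := S.insert i) (by simp [hj, hij.ne']),
      psi_single_of_notMem (S := S.insert j) (by simp [hi, hij.ne]),
      Maya.above_insert_of_lt hj hij, Maya.above_insert_of_le hij.le, ← Finsupp.single_neg]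
    congr 1
    · ext l
      simp only [Maya.mem_insert]
      tauto
    · ring

theorem psiStar_psi_self (j : ℤ) (v : FockSpace R) :
    psiStar R j (psi R j v) = v - psi R j (psiStar R j v) := by
  induction v using Finsupp.induction_linear with
  | zero => simp
  | add v w hv hw => simp only [map_add, hv, hw]; abel
  | single S r =>
    by_cases h : j ∈ S.1
    · rw [psi_single_of_mem h, psiStar_single_of_mem h,
        psi_single_of_notMem (S := S.erase j) (fun h => h.2 rfl),
        Maya.above_erase_of_le le_rfl, ← mul_assoc, ← mul_pow]
      have : (S.erase j).insert j = S := by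
        ext l
        simp only [Maya.mem_insert, Maya.mem_erase]
        grind
      simp [this]
    · rw [psi_single_of_notMem h, psiStar_single_of_notMem h,
        psiStar_single_of_mem (S := S.insert j) (Or.inl rfl),
        Maya.above_insert_of_le le_rfl, ← mul_assoc, ← mul_pow]
      have : (S.insert j).erase j = S := by
        ext l
        simp only [Maya.mem_insert, Maya.mem_erase]
        grind
      simp [this]

theorem psiStar_psi_of_ne {i j : ℤ} (hij : i ≠ j) (v : FockSpace R) :
    psiStar R i (psi R j v) = -psi R j (psiStar R i v) := by
  induction v using Finsupp.induction_linear with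
  | zero => simp
  | add v w hv hw => simp only [map_add, hv, hw]; abel
  | single S r =>
    by_cases hi : i ∈ S.1
    · by_cases hj : j ∈ S.1
      · rw [psi_single_of_mem hj, psiStar_single_of_mem hi,
          psi_single_of_mem (S := S.erase i) ⟨hj, hij.symm⟩, map_zero, neg_zero]
      · rw [psi_single_of_notMem hj, psiStar_single_of_mem hi,
          psi_single_of_notMem (S := S.erase i) (by simp [hj]),
          psiStar_single_of_mem (S := S.insert j) (by simp [hi]), ← Finsupp.single_neg]
        congr 1
        · ext l
          simp only [Maya.mem_insert, Maya.mem_erase]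
          grind
        · rcases hij.lt_or_gt with h | h
          · rw [Maya.above_insert_of_lt hj h, Maya.above_erase_of_le h.le]
            ring
          · rw [Maya.above_insert_of_le h.le, ← Maya.above_erase_of_lt hi h]
            ring
    · by_cases hj : j ∈ S.1
      · simp [psi_single_of_mem hj, psiStar_single_of_notMem hi]
      · rw [psi_single_of_notMem hj, psiStar_single_of_notMem hi,
          psiStar_single_of_notMem (S := S.insert j) (by simp [hij, hi]), map_zero, neg_zero]

theorem psiStar_psi (i j : ℤ) (v : FockSpace R) :
    psiStar R i (psi R j v) = (if i = j then v else 0) - psi R j (psiStar R i v) := by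
  split_ifs with h
  · subst h
    exact psiStar_psi_self i v
  · rw [psiStar_psi_of_ne h, zero_sub]

theorem exists_psi_eq_zero (v : FockSpace R) : ∃ N : ℕ, ∀ i : ℤ, i < -(N : ℤ) → psi R i v = 0 := by
  induction v using Finsupp.induction_linear with
  | zero => exact ⟨0, by simp⟩
  | add v w hv hw =>
    obtain ⟨N, hN⟩ := hv
    obtain ⟨M, hM⟩ := hw
    refine ⟨N + M, fun i hi => ?_⟩
    rw [map_add, hN i (by omega), hM i (by omega), add_zero]
  | single S r =>
    obtain ⟨N, -, hN⟩ := S.exists_bound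
    exact ⟨N, fun i hi => psi_single_of_mem (hN i hi) r⟩

theorem exists_psiStar_eq_zero (v : FockSpace R) :
    ∃ N : ℕ, ∀ i : ℤ, (N : ℤ) < i → psiStar R i v = 0 := by
  induction v using Finsupp.induction_linear with
  | zero => exact ⟨0, by simp⟩
  | add v w hv hw =>
    obtain ⟨N, hN⟩ := hv
    obtain ⟨M, hM⟩ := hw
    refine ⟨N + M, fun i hi => ?_⟩
    rw [map_add, hN i (by omega), hM i (by omega), add_zero]
  | single S r =>
    obtain ⟨N, hN, -⟩ := S.exists_bound
    refine ⟨N, fun i hi => psiStar_single_of_notMem (fun h => ?_) r⟩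
    have := hN i h
    omega

/-! ## The currents -/

/-- For n ≥ 1 the two fermions anticommute, so either one may act on v first: ψ_i kills v for very
negative i, and ψ*_{i+n} for large i + n. One window serves all n at once. -/
theorem exists_psi_psiStar_support (v : FockSpace R) :
    ∃ N : ℕ, ∀ (n : ℕ) (i : ℤ), 1 ≤ n → psi R i (psiStar R (i + n) v) ≠ 0 →
      -(N : ℤ) ≤ i ∧ i + n ≤ N := by
  obtain ⟨N, hN⟩ := exists_psi_eq_zero v
  obtain ⟨M, hM⟩ := exists_psiStar_eq_zero v
  refine ⟨N + M, fun n i hn h => ⟨?_, ?_⟩⟩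
  · by_contra hi
    refine h ?_
    have := psiStar_psi_of_ne (i := i + n) (j := i) (by omega) v
    rw [hN i (by omega), map_zero] at this
    exact neg_eq_zero.mp this.symm
  · by_contra hi
    exact h (by rw [hM _ (by omega), map_zero])

theorem finite_support_psi_psiStar {n : ℕ} (hn : 1 ≤ n) (v : FockSpace R) :
    (Function.support fun i : ℤ => psi R i (psiStar R (i + n) v)).Finite := by
  obtain ⟨N, hN⟩ := exists_psi_psiStar_support v
  refine (Set.finite_Icc (-(N : ℤ)) N).subset fun i hi => ?_
  have := hN n i hn hi
  exact ⟨this.1, by omega⟩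

theorem current_apply {n : ℕ} (hn : 1 ≤ n) (v : FockSpace R) :
    current R n v = ∑ᶠ i : ℤ, psi R i (psiStar R (i + n) v) :=
  linearCombination_finsum_apply (fun i : ℤ => psi R i * psiStar R (i + n))
    (finite_support_psi_psiStar hn) v

theorem exists_current_eq_zero (v : FockSpace R) : ∃ N : ℕ, ∀ n, N ≤ n → current R n v = 0 := by
  obtain ⟨N, hN⟩ := exists_psi_psiStar_support v
  -- Both i and i + n lie in [-N, N], which forces n ≤ 2N.
  refine ⟨2 * N + 1, fun n hn => ?_⟩
  rw [current_apply (by omega)]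
  refine finsum_eq_zero_of_forall_eq_zero fun i => ?_
  by_contra h
  have := hN n i (by omega) h
  omega

/-- Moving ψ_j out past ψ*_{i+n} and ψ_i costs two signs, which cancel; only the contraction at i +
n = j remains. -/
theorem current_psi {n : ℕ} (hn : 1 ≤ n) (j : ℤ) (v : FockSpace R) :
    current R n (psi R j v) = psi R j (current R n v) + psi R (j - n) v := by
  have h1 (i : ℤ) : psi R i (psiStar R (i + n) (psi R j v)) =
      psi R j (psi R i (psiStar R (i + n) v)) + if i = j - n then psi R i v else 0 := by
    rw [psiStar_psi, map_sub, psi_psi i j, sub_neg_eq_add, add_comm]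
    congr 1
    by_cases h : i = j - n
    · rw [if_pos h, if_pos (by omega)]
    · rw [if_neg h, if_neg (by omega), map_zero]
  have hf := finite_support_psi_psiStar hn v
  rw [current_apply hn, current_apply hn, finsum_congr h1, finsum_add_distrib, map_finsum _ hf]
  · congr 1
    rw [finsum_eq_single _ (j - n) fun i hi => if_neg hi, if_pos rfl]
  · refine hf.subset fun i hi h => hi ?_
    simp only [h, map_zero]
  · refine (Set.finite_singleton (j - n)).subset fun i hi => ?_
    by_contra h
    exact hi (if_neg h)

theorem finite_support_smul_current (c : ℕ → R) (v : FockSpace R) :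
    (Function.support fun n => c (n + 1) • current R (n + 1) v).Finite := by
  obtain ⟨N, hN⟩ := exists_current_eq_zero v
  refine (Set.finite_lt_nat N).subset fun n hn => ?_
  by_contra h
  exact hn (by simp only [Set.mem_ofPred_eq] at h; simp [hN (n + 1) (by omega)])

theorem currentSum_apply (c : ℕ → R) (v : FockSpace R) :
    currentSum c v = ∑ᶠ n : ℕ, c (n + 1) • current R (n + 1) v :=
  linearCombination_finsum_apply (fun n => c (n + 1) • current R (n + 1))
    (finite_support_smul_current c) v

end Fermions

/-! ## Fermion fields with power series coefficients -/

section Fields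

open PowerSeries

variable {R : Type*} [CommRing R]

/-- The coefficient of a power series at an integer, zero at negative integers. -/
noncomputable def coeffInt (n : ℤ) : R⟦X⟧ →ₗ[R] R := if 0 ≤ n then coeff n.toNat else 0

theorem coeffInt_of_neg {n : ℤ} (h : n < 0) (f : R⟦X⟧) : coeffInt n f = 0 := by
  rw [coeffInt, if_neg (by omega), LinearMap.zero_apply]

@[simp] theorem coeffInt_natCast (n : ℕ) (f : R⟦X⟧) : coeffInt (n : ℤ) f = coeff n f := by
  rw [coeffInt, if_pos (by omega), Int.toNat_natCast]

theorem coeffInt_X_pow_mul (m : ℕ) (n : ℤ) (f : R⟦X⟧) :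
    coeffInt n (X ^ m * f) = coeffInt (n - m) f := by
  rcases lt_or_ge n 0 with h | h
  · rw [coeffInt_of_neg h, coeffInt_of_neg (by omega)]
  lift n to ℕ using h
  rw [coeffInt_natCast, coeff_X_pow_mul']
  split_ifs with h
  · rw [← Nat.cast_sub h, coeffInt_natCast]
  · rw [coeffInt_of_neg (by omega)]

theorem finite_support_coeffInt_smul_psi (j : ℤ) (f : R⟦X⟧) (v : FockSpace R) :
    (Function.support fun i : ℤ => coeffInt (j - i) f • psi R i v).Finite := by
  obtain ⟨N, hN⟩ := exists_psi_eq_zero v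
  refine (Set.finite_Icc (-(N : ℤ)) j).subset fun i hi => ⟨?_, ?_⟩
  · by_contra h
    exact hi (by simp [hN i (by omega)])
  · by_contra h
    exact hi (by simp [coeffInt_of_neg (show j - i < 0 by omega)])

/-- The operator `∑_{n ≥ 0} f_n ψ_{j-n}` for a power series `f`. -/
noncomputable def psiSeries (j : ℤ) : R⟦X⟧ →ₗ[R] Module.End R (FockSpace R) where
  toFun f := Finsupp.linearCombination R fun S : Maya =>
    ∑ᶠ i : ℤ, coeffInt (j - i) f • psi R i (Finsupp.single S 1)
  map_add' f g := by
    ext1 S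
    ext1
    simp only [LinearMap.comp_apply, Finsupp.lsingle_apply, Finsupp.linearCombination_single,
      one_smul, LinearMap.add_apply, map_add, add_smul]
    exact finsum_add_distrib (finite_support_coeffInt_smul_psi j f _)
      (finite_support_coeffInt_smul_psi j g _)
  map_smul' r f := by
    ext1 S
    ext1
    simp only [LinearMap.comp_apply, Finsupp.lsingle_apply, Finsupp.linearCombination_single,
      one_smul, LinearMap.smul_apply, map_smul, smul_eq_mul, mul_smul, RingHom.id_apply]
    exact (smul_finsum' r (finite_support_coeffInt_smul_psi j f _)).symm

theorem psiSeries_apply (j : ℤ) (f : R⟦X⟧) (v : FockSpace R) :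
    psiSeries j f v = ∑ᶠ i : ℤ, coeffInt (j - i) f • psi R i v :=
  linearCombination_finsum_apply (fun i : ℤ => coeffInt (j - i) f • psi R i)
    (finite_support_coeffInt_smul_psi j f) v

theorem psiSeries_one (j : ℤ) : psiSeries j (1 : R⟦X⟧) = psi R j := by
  ext1 S
  ext1
  simp only [LinearMap.comp_apply]
  rw [psiSeries_apply, finsum_eq_single _ j]
  · rw [sub_self, show (0 : ℤ) = (0 : ℕ) from rfl, coeffInt_natCast]
    simp
  · intro i hi
    rcases lt_or_ge (j - i) 0 with h | h
    · rw [coeffInt_of_neg h, zero_smul]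
    · obtain ⟨n, hn⟩ := Int.eq_ofNat_of_zero_le h
      rw [hn, coeffInt_natCast, coeff_one, if_neg (by omega), zero_smul]

theorem psiSeries_X_pow_mul (j : ℤ) (m : ℕ) (f : R⟦X⟧) :
    psiSeries j (X ^ m * f) = psiSeries (j - m) f := by
  ext1 S
  ext1
  simp only [LinearMap.comp_apply]
  rw [psiSeries_apply, psiSeries_apply]
  refine finsum_congr fun i => ?_
  rw [coeffInt_X_pow_mul, sub_right_comm]

theorem psiSeries_apply_eq_zero {j : ℤ} {v : FockSpace R} (h : ∀ i ≤ j, psi R i v = 0)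
    (f : R⟦X⟧) : psiSeries j f v = 0 := by
  rw [psiSeries_apply]
  refine finsum_eq_zero_of_forall_eq_zero fun i => ?_
  rcases le_or_gt i j with hi | hi
  · rw [h i hi, smul_zero]
  · rw [coeffInt_of_neg (by omega), zero_smul]

/-- Continuity in the X-adic topology: on a fixed vector, a series may be replaced by a truncation.
-/
theorem exists_psiSeries_eq_zero (j : ℤ) (v : FockSpace R) :
    ∃ N : ℕ, ∀ f : R⟦X⟧, X ^ N ∣ f → psiSeries j f v = 0 := by
  obtain ⟨N, hN⟩ := exists_psi_eq_zero v
  refine ⟨N + j.natAbs + 1, ?_⟩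
  rintro _ ⟨g, rfl⟩
  rw [psiSeries_X_pow_mul]
  exact psiSeries_apply_eq_zero (fun i hi => hN i (by omega)) g

theorem psiStar_psiSeries (k j : ℤ) (f : R⟦X⟧) (v : FockSpace R) :
    psiStar R k (psiSeries j f v) = coeffInt (j - k) f • v - psiSeries j f (psiStar R k v) := by
  have hf := finite_support_coeffInt_smul_psi j f v
  rw [psiSeries_apply, psiSeries_apply, map_finsum _ hf]
  simp only [map_smul, psiStar_psi, smul_sub]
  rw [finsum_sub_distrib _ (finite_support_coeffInt_smul_psi j f _),
    finsum_eq_single _ k fun i hi => by rw [if_neg hi.symm, smul_zero], if_pos rfl]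
  refine (Set.finite_singleton k).subset fun i hi => ?_
  by_contra h
  exact hi (by simp only; rw [if_neg (fun h' => h h'.symm), smul_zero])

/-- The power series `∑_{n ≥ 1} c_n X^n`. -/
noncomputable def posSeries (c : ℕ → R) : R⟦X⟧ := X * mk fun n => c (n + 1)

theorem X_dvd_posSeries (c : ℕ → R) : X ∣ posSeries c := Dvd.intro _ rfl

theorem currentSum_psi (c : ℕ → R) (j : ℤ) (v : FockSpace R) :
    currentSum c (psi R j v) = psi R j (currentSum c v) + psiSeries j (posSeries c) v := by
  have hX := finite_support_smul_current c v
  have hinj : Function.Injective fun n : ℕ => j - ((n : ℤ) + 1) := fun m n h => by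
    simp only at h
    omega
  have h1 : psiSeries j (posSeries c) v =
      ∑ᶠ n : ℕ, c (n + 1) • psi R (j - ((n : ℤ) + 1)) v := by
    rw [posSeries, ← pow_one (X : R⟦X⟧), psiSeries_X_pow_mul, psiSeries_apply]
    -- Indices outside the range of n ↦ j - (n + 1) are those i ≥ j, where the coefficient is taken
    -- at a negative integer.
    trans ∑ᶠ (i : ℤ) (_ : i ∈ Set.range fun n : ℕ => j - ((n : ℤ) + 1)),
      coeffInt (j - (1 : ℕ) - i) (mk fun n => c (n + 1)) • psi R i v
    · classical
      refine finsum_congr fun i => ?_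
      rw [finsum_eq_if]
      split_ifs with h
      · rfl
      · have : j - (1 : ℕ) - i < 0 := by
          by_contra hi
          exact h ⟨(j - 1 - i).toNat, by simp only; omega⟩
        rw [coeffInt_of_neg this, zero_smul]
    · rw [finsum_mem_range hinj]
      refine finsum_congr fun n => ?_
      rw [show j - (1 : ℕ) - (j - ((n : ℤ) + 1)) = n by push_cast; ring, coeffInt_natCast,
        coeff_mk]
  rw [h1, currentSum_apply, currentSum_apply, map_finsum _ hX, ← finsum_add_distrib]
  · refine finsum_congr fun n => ?_
    rw [current_psi (by omega), smul_add, map_smul]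
    push_cast
    rfl
  · refine hX.subset fun n hn h => hn ?_
    simp only [h, map_zero]
  · obtain ⟨N, hN⟩ := exists_psi_eq_zero v
    refine (Set.finite_lt_nat (N + j.natAbs)).subset fun n hn => ?_
    by_contra h
    simp only [Set.mem_ofPred_eq] at h
    exact hn (by simp only; rw [hN _ (by omega), smul_zero])

theorem exists_eq_sum_add_X_pow_mul (f : R⟦X⟧) (N : ℕ) :
    ∃ g, f = (∑ n ∈ Finset.range N, coeff n f • X ^ n) + X ^ N * g := by
  have : X ^ N ∣ f - ∑ n ∈ Finset.range N, coeff n f • (X : R⟦X⟧) ^ n := by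
    rw [X_pow_dvd_iff]
    intro m hm
    simp [coeff_X_pow, hm]
  obtain ⟨g, hg⟩ := this
  exact ⟨g, by rw [← hg]; ring⟩

/-- Both sides are linear in f. On a monomial this is `currentSum_psi` with a shifted index, and a
tail divisible by a high power of X acts as zero on both v and `currentSum c v`. -/
theorem currentSum_psiSeries (c : ℕ → R) (j : ℤ) (f : R⟦X⟧) (v : FockSpace R) :
    currentSum c (psiSeries j f v) =
      psiSeries j f (currentSum c v) + psiSeries j (posSeries c * f) v := by
  obtain ⟨N₁, h₁⟩ := exists_psiSeries_eq_zero j v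
  obtain ⟨N₂, h₂⟩ := exists_psiSeries_eq_zero j (currentSum c v)
  obtain ⟨g, hg⟩ := exists_eq_sum_add_X_pow_mul f (N₁ + N₂)
  have d₁ (g : R⟦X⟧) : psiSeries j (X ^ (N₁ + N₂) * g) v = 0 :=
    h₁ _ (Dvd.dvd.mul_right (pow_dvd_pow X (by omega)) g)
  have d₂ : psiSeries j (X ^ (N₁ + N₂) * g) (currentSum c v) = 0 :=
    h₂ _ (Dvd.dvd.mul_right (pow_dvd_pow X (by omega)) g)
  have d₃ : psiSeries j (posSeries c * (X ^ (N₁ + N₂) * g)) v = 0 := by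
    rw [mul_left_comm, d₁]
  rw [hg]
  simp only [map_add, mul_add, LinearMap.add_apply, d₁, d₂, d₃, add_zero, map_sum,
    LinearMap.sum_apply, Finset.mul_sum, map_smul, LinearMap.smul_apply, mul_smul_comm]
  rw [← Finset.sum_add_distrib]
  refine Finset.sum_congr rfl fun n _ => ?_
  rw [mul_comm (posSeries c), psiSeries_X_pow_mul, ← mul_one (X ^ n : R⟦X⟧), psiSeries_X_pow_mul,
    psiSeries_one, currentSum_psi, smul_add]

/-- The binomial (Leibniz) formula for iterating a commutator that multiplies the symbol by
`posSeries c`. -/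
theorem currentSum_pow_psiSeries (c : ℕ → R) (j : ℤ) (n : ℕ) (f : R⟦X⟧) (v : FockSpace R) :
    (currentSum c ^ n) (psiSeries j f v) = ∑ p ∈ Finset.HasAntidiagonal.antidiagonal n,
      n.choose p.1 • psiSeries j (posSeries c ^ p.1 * f) ((currentSum c ^ p.2) v) := by
  induction n generalizing f v with
  | zero => simp
  | succ n ih =>
    rw [pow_succ, Module.End.mul_apply, currentSum_psiSeries, map_add, ih, ih, add_comm,
      Finset.sum_antidiagonal_choose_succ_nsmul
        (fun a b => psiSeries j (posSeries c ^ a * f) ((currentSum c ^ b) v)), add_comm]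
    congr 1
    all_goals
      refine Finset.sum_congr rfl fun p hp => ?_
      simp only [← Module.End.mul_apply, ← pow_succ, ← mul_assoc]
    rw [← Nat.choose_symm_of_eq_add (Finset.HasAntidiagonal.mem_antidiagonal.mp hp).symm]

end Fields

/-! ## Local nilpotency and exponentials -/

namespace Maya

/-- The basis index of `v_{-m-1} ∧ v_{-m-2} ∧ ⋯`. -/
def lowered (m : ℕ) : Maya :=
  ⟨{j | j < -(m : ℤ)}, by
    refine ⟨?_, (Set.finite_Ico (-(m : ℤ)) 0).subset fun j hj => ⟨not_lt.mp hj.1, hj.2⟩⟩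
    convert Set.finite_empty
    ext j
    simp only [Set.mem_ofPred_eq, Set.mem_empty_iff_false, iff_false]
    omega⟩

@[simp] theorem mem_lowered {m : ℕ} {j : ℤ} : j ∈ (lowered m).1 ↔ j < -(m : ℤ) := Iff.rfl

theorem lowered_zero : lowered 0 = vacuum := by
  ext j
  simp [vacuum]

end Maya

section Nilpotent

open PowerSeries

variable {R : Type*} [CommRing R]

/-- Every basis vector is, up to sign, a product of ψ's applied to a lowered vacuum; the induction
is on the number of indices at or above -m, those below being all occupied. -/
theorem fockSpace_induction {P : FockSpace R → Prop}
    (lowered : ∀ m, P (Finsupp.single (Maya.lowered m) 1))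
    (add : ∀ v w, P v → P w → P (v + w)) (smul : ∀ (r : R) v, P v → P (r • v))
    (psi : ∀ j v, P v → P (psi R j v)) (v : FockSpace R) : P v := by
  have key (m n : ℕ) : ∀ S : Maya, (∀ i, i < -(m : ℤ) → i ∈ S.1) →
      S.above (-(m : ℤ) - 1) = n → P (Finsupp.single S 1) := by
    induction n with
    | zero =>
      intro S hS h
      have h0 := (Set.ncard_eq_zero (S.finite_above _)).mp h
      have : S = Maya.lowered m := by
        ext i
        refine ⟨fun hi => ?_, hS i⟩
        by_contra hlt
        rw [Maya.mem_lowered] at hlt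
        exact (Set.eq_empty_iff_forall_notMem.mp h0) i ⟨hi, by omega⟩
      rw [this]
      exact lowered m
    | succ n ih =>
      intro S hS h
      obtain ⟨j, hj, hjm⟩ := Set.nonempty_of_ncard_ne_zero (h.trans_ne (Nat.succ_ne_zero n))
      have hcard : (S.erase j).above (-(m : ℤ) - 1) = n := by
        have := Maya.above_erase_of_lt hj hjm
        omega
      -- The scalar cancels the sign produced when ψ_j puts j back.
      have h1 := smul ((-1) ^ (S.erase j).above j) _ (psi j _ (ih (S.erase j)
        (fun i hi => Maya.mem_erase.mpr ⟨hS i hi, by omega⟩) hcard))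
      have h2 : (S.erase j).insert j = S := by
        ext l
        simp only [Maya.mem_insert, Maya.mem_erase]
        grind
      rwa [psi_single_of_notMem (fun h => (Maya.mem_erase.mp h).2 rfl), h2, Finsupp.smul_single,
        smul_eq_mul, ← mul_assoc, ← mul_pow, neg_one_mul, neg_neg, one_pow, one_mul] at h1
  induction v using Finsupp.induction_linear with
  | zero => simpa using smul 0 _ (lowered 0)
  | add v w hv hw => exact add v w hv hw
  | single S r =>
    obtain ⟨N, -, hN⟩ := S.exists_bound
    simpa using smul r _ (key N _ S hN rfl)

/-- Each term removes an occupied index and tries to create a smaller one, which is still occupied.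
-/
theorem current_lowered {n : ℕ} (hn : 1 ≤ n) (m : ℕ) (r : R) :
    current R n (Finsupp.single (Maya.lowered m) r) = 0 := by
  rw [current_apply hn]
  refine finsum_eq_zero_of_forall_eq_zero fun i => ?_
  by_cases h : i + n < -(m : ℤ)
  · rw [psiStar_single_of_mem h, psi_single_of_mem]
    simp only [Maya.mem_erase, Maya.mem_lowered]
    omega
  · rw [psiStar_single_of_notMem h, map_zero]

theorem currentSum_lowered (c : ℕ → R) (m : ℕ) (r : R) :
    currentSum c (Finsupp.single (Maya.lowered m) r) = 0 := by
  rw [currentSum_apply]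
  refine finsum_eq_zero_of_forall_eq_zero fun n => ?_
  rw [current_lowered (by omega), smul_zero]

theorem exists_psiSeries_family_eq_zero {ι : Type*} (j : ℤ)
    (v : ι → FockSpace R) (s : Finset ι) :
    ∃ A : ℕ, ∀ g : R⟦X⟧, X ^ A ∣ g → ∀ b ∈ s, psiSeries j g (v b) = 0 := by
  choose A hA using fun b => exists_psiSeries_eq_zero j (v b)
  exact ⟨s.sup A, fun g hg b hb => hA b g ((pow_dvd_pow X (Finset.le_sup hb)).trans hg)⟩

theorem exists_currentSum_pow_eq_zero (c : ℕ → R) (v : FockSpace R) :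
    ∃ N : ℕ, ∀ n, N ≤ n → (currentSum c ^ n) v = 0 := by
  induction v using fockSpace_induction with
  | lowered m =>
    refine ⟨1, fun n hn => ?_⟩
    obtain ⟨n, rfl⟩ := Nat.exists_eq_add_of_le' hn
    rw [pow_succ, Module.End.mul_apply, currentSum_lowered, map_zero]
  | add v w hv hw =>
    obtain ⟨N, hN⟩ := hv
    obtain ⟨M, hM⟩ := hw
    exact ⟨N + M, fun n hn => by rw [map_add, hN n (by omega), hM n (by omega), add_zero]⟩
  | smul r v hv =>
    obtain ⟨N, hN⟩ := hv
    exact ⟨N, fun n hn => by rw [map_smul, hN n hn, smul_zero]⟩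
  | psi j v hv =>
    obtain ⟨B, hB⟩ := hv
    obtain ⟨A, hA⟩ := exists_psiSeries_family_eq_zero j (fun b => (currentSum c ^ b) v)
      (Finset.range B)
    -- If p.1 + p.2 ≥ A + B, then either p.2 ≥ B and the power kills v, or p.1 ≥ A and the symbol is
    -- divisible by X^A.
    refine ⟨A + B, fun n hn => ?_⟩
    rw [← psiSeries_one, currentSum_pow_psiSeries]
    refine Finset.sum_eq_zero fun p hp => ?_
    rw [Finset.HasAntidiagonal.mem_antidiagonal] at hp
    by_cases hb : p.2 < B
    · rw [hA _ _ p.2 (Finset.mem_range.mpr hb), smul_zero]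
      exact Dvd.dvd.mul_right ((pow_dvd_pow X (by omega)).trans
        (pow_dvd_pow_of_dvd (X_dvd_posSeries c) p.1)) _
    · rw [hB _ (by omega), map_zero, smul_zero]

theorem currentSum_neg (c : ℕ → R) : -currentSum c = currentSum fun n => -c n := by
  ext1 S
  ext1
  simp only [LinearMap.comp_apply, LinearMap.neg_apply, currentSum_apply, neg_smul]
  rw [finsum_neg_distrib]

/-- Cauchy product rearrangement, used to split the exponential of a binomial expansion into two
independent sums. -/
theorem finsum_sum_antidiagonal {M : Type*} [AddCommMonoid M] (T : ℕ × ℕ → M) (A B : ℕ)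
    (hT : ∀ p, ¬ (p.1 < A ∧ p.2 < B) → T p = 0) :
    ∑ᶠ n, ∑ p ∈ Finset.HasAntidiagonal.antidiagonal n, T p =
      ∑ a ∈ Finset.range A, ∑ b ∈ Finset.range B, T (a, b) := by
  rw [finsum_eq_sum_of_support_subset (s := Finset.range (A + B)), ← Finset.sum_product',
    ← Finset.sum_fiberwise_of_maps_to (s := Finset.range A ×ˢ Finset.range B)
      (t := Finset.range (A + B)) (g := fun p => p.1 + p.2)]
  · refine Finset.sum_congr rfl fun n _ => (Finset.sum_subset ?_ ?_).symm
    · intro p hp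
      simpa using (Finset.mem_filter.mp hp).2
    · intro p hp hp'
      refine hT p fun h => hp' ?_
      rw [Finset.HasAntidiagonal.mem_antidiagonal] at hp
      simp [h, hp]
  · intro p hp
    simp only [Finset.mem_product, Finset.mem_range] at hp ⊢
    omega
  · intro n hn
    by_contra h
    simp only [Finset.coe_range, Set.mem_Iio] at h
    refine hn (Finset.sum_eq_zero fun p hp => hT p ?_)
    rw [Finset.HasAntidiagonal.mem_antidiagonal] at hp
    omega

variable {k : Type*} [Field k] [Algebra k R]

theorem expOp_apply {X : Module.End R (FockSpace R)}
    (hX : ∀ v, ∃ N : ℕ, ∀ n, N ≤ n → (X ^ n) v = 0) (v : FockSpace R) :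
    expOp k X v = ∑ᶠ n : ℕ, ((n.factorial : k)⁻¹) • (X ^ n) v := by
  refine linearCombination_finsum_apply (fun n : ℕ => ((n.factorial : k)⁻¹) • X ^ n)
    (fun v => ?_) v
  obtain ⟨N, hN⟩ := hX v
  refine (Set.finite_lt_nat N).subset fun n hn => ?_
  by_contra h
  exact hn (by simp only [Set.mem_ofPred_eq, not_lt] at h; simp [hN n h])

theorem expOp_currentSum_lowered (c : ℕ → R) (m : ℕ) :
    expOp k (currentSum c) (Finsupp.single (Maya.lowered m) 1) =
      Finsupp.single (Maya.lowered m) 1 := by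
  rw [expOp_apply (exists_currentSum_pow_eq_zero c), finsum_eq_single _ 0]
  · simp
  · intro n hn
    obtain ⟨n, rfl⟩ := Nat.exists_eq_succ_of_ne_zero hn
    rw [pow_succ, Module.End.mul_apply, currentSum_lowered, map_zero, smul_zero]

/-- The remainders E_A satisfy E_{A+1}' = f' E_A, and E_{A+1} has no constant term, so each step
gains a power of X. Characteristic zero makes m + 1 invertible when integrating. -/
theorem X_pow_dvd_sub_sum_pow [CharZero k] {f F : R⟦X⟧} (hf : X ∣ f)
    (h0 : constantCoeff F = 1) (hF : derivative R F = derivative R f * F) (A : ℕ) :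
    X ^ A ∣ F - ∑ a ∈ Finset.range A, ((a.factorial : k)⁻¹) • f ^ a := by
  induction A with
  | zero => simp
  | succ A ih =>
    have hD : derivative R (F - ∑ a ∈ Finset.range (A + 1), ((a.factorial : k)⁻¹) • f ^ a) =
        derivative R f * (F - ∑ a ∈ Finset.range A, ((a.factorial : k)⁻¹) • f ^ a) := by
      rw [map_sub, hF, mul_sub, map_sum, Finset.sum_range_succ', Finset.mul_sum]
      have : derivative R (((Nat.factorial 0 : k)⁻¹) • f ^ 0) = 0 := by simp
      rw [this, add_zero]
      congr 1
      refine Finset.sum_congr rfl fun a _ => ?_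
      have h1 (x : k) (g : R⟦X⟧) : x • g = algebraMap k R x • g := (algebraMap_smul R x g).symm
      rw [h1, Derivation.map_smul, ← h1, derivative_pow, Nat.add_sub_cancel, mul_comm (_ * _),
        mul_smul_comm]
      have h2 : ((a + 1 : ℕ) : R⟦X⟧) * f ^ a = ((a + 1 : ℕ) : k) • f ^ a := by
        rw [← nsmul_eq_mul, Nat.cast_smul_eq_nsmul]
      rw [h2, mul_smul_comm, smul_smul, Nat.factorial_succ]
      congr 1
      have := Nat.cast_ne_zero (R := k).mpr (Nat.succ_ne_zero a)
      have := Nat.cast_ne_zero (R := k).mpr (Nat.factorial_ne_zero a)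
      push_cast at *
      field_simp
    rw [X_pow_dvd_iff]
    intro m hm
    cases m with
    | zero =>
      have hf0 : constantCoeff f = 0 := X_dvd_iff.mp hf
      rw [coeff_zero_eq_constantCoeff_apply, map_sub, h0, map_sum, Finset.sum_range_succ',
        Finset.sum_eq_zero]
      · simp
      · intro a _
        rw [← coeff_zero_eq_constantCoeff_apply, coeff_smul, coeff_zero_eq_constantCoeff_apply,
          map_pow, hf0]
        simp
    | succ m =>
      have h1 := congrArg (coeff m) hD
      rw [coeff_derivative, X_pow_dvd_iff.mp (Dvd.dvd.mul_left ih _) m (by omega)] at h1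
      have h2 : ((m + 1 : ℕ) : k) ≠ 0 := Nat.cast_ne_zero.mpr (Nat.succ_ne_zero m)
      have h3 : IsUnit ((m : R) + 1) := by
        have := (IsUnit.mk0 _ h2).map (algebraMap k R)
        simpa using this
      exact h3.mul_left_eq_zero.mp h1

/-- In the expansion of Xⁿ/n! into products of Xᵃ/a! and Xᵇ/b!, the sum over a is a truncated
exponential of `posSeries c`. It agrees with F modulo X^A, and symbols divisible by X^A annihilate
the finitely many vectors involved. -/
theorem expOp_psiSeries [CharZero k] {c : ℕ → R} {F : R⟦X⟧} (h0 : constantCoeff F = 1)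
    (hF : derivative R F = derivative R (posSeries c) * F) (j : ℤ) (f : R⟦X⟧)
    (v : FockSpace R) :
    expOp k (currentSum c) (psiSeries j f v) =
      psiSeries j (F * f) (expOp k (currentSum c) v) := by
  obtain ⟨B, hB⟩ := exists_currentSum_pow_eq_zero c v
  obtain ⟨A, hA⟩ := exists_psiSeries_family_eq_zero j (fun b => (currentSum c ^ b) v)
    (Finset.range B)
  have hv : expOp k (currentSum c) v =
      ∑ b ∈ Finset.range B, ((b.factorial : k)⁻¹) • (currentSum c ^ b) v := by
    rw [expOp_apply (exists_currentSum_pow_eq_zero c), finsum_eq_sum_of_support_subset]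
    intro b hb
    by_contra h
    simp only [Finset.coe_range, Set.mem_Iio, not_lt] at h
    exact hb (by simp [hB b h])
  have hsm (x : k) (g : R⟦X⟧) : psiSeries j (x • g) = x • psiSeries j g :=
    LinearMap.map_smul_of_tower _ x g
  rw [expOp_apply (exists_currentSum_pow_eq_zero c), hv, map_sum, finsum_congr fun n => ?_,
    finsum_sum_antidiagonal (fun p => ((p.1.factorial : k)⁻¹) • ((p.2.factorial : k)⁻¹) •
      psiSeries j (posSeries c ^ p.1 * f) ((currentSum c ^ p.2) v)) A B]
  · rw [Finset.sum_comm]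
    refine Finset.sum_congr rfl fun b hb => ?_
    obtain ⟨g, hg⟩ := X_pow_dvd_sub_sum_pow (k := k) (X_dvd_posSeries c) h0 hF A
    rw [sub_eq_iff_eq_add] at hg
    have := hA (X ^ A * g * f) (Dvd.intro _ (mul_assoc _ _ _).symm) b hb
    rw [LinearMap.map_smul_of_tower, hg, add_mul, map_add, LinearMap.add_apply, this, zero_add,
      Finset.sum_mul, map_sum, LinearMap.sum_apply, Finset.smul_sum]
    refine Finset.sum_congr rfl fun a _ => ?_
    rw [smul_mul_assoc, hsm, LinearMap.smul_apply, smul_comm]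
  · intro p hp
    by_cases hb : p.2 < B
    · rw [hA _ _ p.2 (Finset.mem_range.mpr hb), smul_zero, smul_zero]
      exact Dvd.dvd.mul_right ((pow_dvd_pow X (by omega)).trans
        (pow_dvd_pow_of_dvd (X_dvd_posSeries c) p.1)) _
    · rw [hB _ (by omega), map_zero, smul_zero, smul_zero]
  · rw [currentSum_pow_psiSeries, Finset.smul_sum]
    refine Finset.sum_congr rfl fun p hp => ?_
    rw [Finset.HasAntidiagonal.mem_antidiagonal] at hp
    rw [← Nat.cast_smul_eq_nsmul k, smul_smul, smul_smul, ← hp]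
    congr 1
    have h1 : (((p.1 + p.2).factorial : ℕ) : k) ≠ 0 := Nat.cast_ne_zero.mpr (Nat.factorial_ne_zero _)
    have h2 : ((p.1.factorial : ℕ) : k) ≠ 0 := Nat.cast_ne_zero.mpr (Nat.factorial_ne_zero _)
    have h3 : ((p.2.factorial : ℕ) : k) ≠ 0 := Nat.cast_ne_zero.mpr (Nat.factorial_ne_zero _)
    have h4 := congrArg (Nat.cast (R := k)) ((Nat.choose_symm_add (a := p.1) (b := p.2) ▸
      Nat.add_choose_mul_factorial_mul_factorial p.1 p.2))
    push_cast at h4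
    field_simp
    linear_combination h4

end Nilpotent

/-! ## Products of fermion fields -/

section Wick

variable {R M : Type*} [CommRing R] [AddCommGroup M] [Module R M]

/-- An operator which anticommutes with each `Ψ i` up to the scalar `α i` and kills `u` contracts a
product of the `Ψ i` applied to `u`. -/
theorem wick_contraction {a : Module.End R M} {u : M} (hu : a u = 0) {s : ℕ}
    (Ψ : Fin (s + 1) → Module.End R M) (α : Fin (s + 1) → R)
    (h : ∀ i v, a (Ψ i v) = α i • v - Ψ i (a v)) :
    a ((List.ofFn Ψ).prod u) =
      ∑ i : Fin (s + 1), ((-1) ^ (i : ℕ) * α i) • (List.ofFn fun l => Ψ (i.succAbove l)).prod u := by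
  induction s with
  | zero => simp [h, hu]
  | succ s ih =>
    rw [List.ofFn_succ, List.prod_cons, Module.End.mul_apply, h,
      ih (fun i => Ψ i.succ) (fun i => α i.succ) (fun i => h i.succ), map_sum, Fin.sum_univ_succ (n := s + 1),
      sub_eq_add_neg, ← Finset.sum_neg_distrib]
    congr 1
    · simp
    · refine Finset.sum_congr rfl fun i _ => ?_
      rw [List.ofFn_succ (f := fun l => Ψ (i.succ.succAbove l)), List.prod_cons,
        Module.End.mul_apply, Fin.succ_succAbove_zero, map_smul, ← neg_smul, Fin.val_succ]
      simp only [Fin.succ_succAbove_succ]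
      congr 1
      ring

end Wick

section Products

open PowerSeries

variable {R : Type*} [CommRing R]

theorem apply_prod_psiSeries {T : Module.End R (FockSpace R)} {G : R⟦X⟧} {u : FockSpace R}
    (hu : T u = u) (hT : ∀ j f v, T (psiSeries j f v) = psiSeries j (G * f) (T v)) {s : ℕ}
    (j : Fin s → ℤ) (f : Fin s → R⟦X⟧) :
    T ((List.ofFn fun i => psiSeries (j i) (f i)).prod u) =
      (List.ofFn fun i => psiSeries (j i) (G * f i)).prod u := by
  induction s with
  | zero => simpa using hu
  | succ s ih =>
    simp only [List.ofFn_succ, List.prod_cons, Module.End.mul_apply, hT]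
    rw [ih]

/-- Factor i is crossed by the i copies of T to its left, each contributing G; every T is finally
absorbed by u. -/
theorem prod_psiSeries_mul_apply {T : Module.End R (FockSpace R)} {G : R⟦X⟧} {u : FockSpace R}
    (hu : T u = u) (hT : ∀ j f v, T (psiSeries j f v) = psiSeries j (G * f) (T v)) {s : ℕ}
    (j : Fin s → ℤ) (f : Fin s → R⟦X⟧) :
    (List.ofFn fun i => psiSeries (j i) (f i) * T).prod u =
      (List.ofFn fun i : Fin s => psiSeries (j i) (G ^ (i : ℕ) * f i)).prod u := by
  induction s with
  | zero => simp
  | succ s ih =>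
    simp only [List.ofFn_succ, List.prod_cons, Module.End.mul_apply]
    rw [ih, apply_prod_psiSeries hu hT]
    simp only [Fin.val_zero, pow_zero, one_mul, Fin.val_succ, pow_succ', mul_assoc]

theorem ketNeg_eq (s : ℕ) : ketNeg R s = Finsupp.single (Maya.lowered s) 1 := by
  induction s with
  | zero => rw [ketNeg, Maya.lowered_zero]
  | succ s ih =>
    -- The index removed is the largest one, so no sign appears.
    have h : (Maya.lowered s).above (-((s : ℤ) + 1)) = 0 := by
      refine (Set.ncard_eq_zero (Maya.finite_above _ _)).mpr
        (Set.eq_empty_iff_forall_notMem.mpr fun i hi => ?_)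
      have h1 : i < -(s : ℤ) := hi.1
      have h2 : -((s : ℤ) + 1) < i := hi.2
      omega
    rw [ketNeg, ih, psiStar_single_of_mem (Maya.mem_lowered.mpr (by omega)), h, pow_zero, one_mul]
    congr 1
    ext i
    simp only [Maya.mem_erase, Maya.mem_lowered]
    omega

/-- Adjoint form of the recursion for `ketNeg`: it trades the bra at level m for the bra at level m
+ 1 preceded by one contraction. -/
theorem psiStar_apply_lowered_succ (m : ℕ) (v : FockSpace R) :
    psiStar R (-((m : ℤ) + 1)) v (Maya.lowered (m + 1)) = v (Maya.lowered m) := by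
  induction v using Finsupp.induction_linear with
  | zero => simp
  | add v w hv hw => simp only [map_add, Finsupp.add_apply, hv, hw]
  | single S r =>
    by_cases hS : S = Maya.lowered m
    · have h := ketNeg_eq (R := R) (m + 1)
      rw [ketNeg, ketNeg_eq] at h
      have hr : Finsupp.single S r = r • Finsupp.single (Maya.lowered m) (1 : R) := by simp [hS]
      rw [hr, map_smul, h]
      simp
    · rw [Finsupp.single_eq_of_ne (Ne.symm hS)]
      by_cases hm : -((m : ℤ) + 1) ∈ S.1
      · rw [psiStar_single_of_mem hm, Finsupp.single_eq_of_ne]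
        intro h
        refine hS ?_
        ext i
        have := congrArg (fun T : Maya => i ∈ T.1) h
        simp only [Maya.mem_erase, Maya.mem_lowered, eq_iff_iff] at this ⊢
        by_cases hi : i = -((m : ℤ) + 1)
        · subst hi
          simp only [hm, true_iff]
          omega
        · simp only [hi, ne_eq, not_false_eq_true, and_true] at this
          rw [← this]
          omega
      · rw [psiStar_single_of_notMem hm, Finsupp.zero_apply]

/-- Contraction with ψ*_{-m-1} produces the first column; what is left after omitting factor i is
the same problem at level m + 1, that is, the complementary minor. Hence m must vary in the
induction. -/
theorem prod_psiSeries_apply_lowered (m s : ℕ) (j : Fin s → ℤ) (f : Fin s → R⟦X⟧) :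
    (List.ofFn fun i => psiSeries (j i) (f i)).prod (Finsupp.single (Maya.lowered (m + s)) 1)
      (Maya.lowered m) =
    Matrix.det (Matrix.of fun i l : Fin s => coeffInt (j i + (m + l + 1)) (f i)) := by
  induction s generalizing m with
  | zero => simp
  | succ s ih =>
    have hu : psiStar R (-((m : ℤ) + 1)) (Finsupp.single (Maya.lowered (m + (s + 1))) 1) = 0 :=
      psiStar_single_of_notMem (by rw [Maya.mem_lowered]; omega) 1
    rw [← psiStar_apply_lowered_succ, wick_contraction hu (fun i => psiSeries (j i) (f i))
      (fun i => coeffInt (j i - -((m : ℤ) + 1)) (f i)) fun i v => psiStar_psiSeries _ _ _ _,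
      Finsupp.finsetSum_apply, Matrix.det_succ_column_zero]
    refine Finset.sum_congr rfl fun i _ => ?_
    rw [Finsupp.smul_apply, show m + (s + 1) = m + 1 + s by ring,
      ih (m + 1) (fun l => j (i.succAbove l)) fun l => f (i.succAbove l), smul_eq_mul]
    have h1 : coeffInt (j i - -((m : ℤ) + 1)) (f i) =
        Matrix.of (fun i l : Fin (s + 1) => coeffInt (j i + (m + l + 1)) (f i)) i 0 := by
      rw [sub_neg_eq_add]
      simp
    rw [h1]
    congr 2
    ext a b
    simp only [Matrix.of_apply, Matrix.submatrix_apply, Fin.val_succ]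
    congr 2
    push_cast
    ring

/-- The determinant of a matrix which is upper unitriangular from the row `l` on does not depend on
its size. -/
theorem det_eq_of_unitriangular_rows {l r : ℕ} (hr : l ≤ r) (a : ℕ → ℕ → R)
    (h0 : ∀ i j, l ≤ i → j < i → a i j = 0) (h1 : ∀ i, l ≤ i → a i i = 1) :
    Matrix.det (Matrix.of fun i j : Fin r => a i j) =
      Matrix.det (Matrix.of fun i j : Fin l => a i j) := by
  induction r, hr using Nat.le_induction with
  | base => rfl
  | succ r hr ih =>
    rw [Matrix.det_succ_row _ (Fin.last r), Finset.sum_eq_single (Fin.last r), ← ih]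
    -- The cofactor sign at the last diagonal position is (-1)^(2r) = 1.
    · simp only [Matrix.of_apply, Fin.val_last, h1 r hr, mul_one, ← two_mul, pow_mul]
      simp only [even_two, Even.neg_pow, one_pow, one_mul]
      congr 1
      ext i j
      simp
    · intro j _ hj
      have : (j : ℕ) < r := Fin.val_lt_last hj
      simp [h0 r j hr this]
    · simp

theorem bra_expOp_prod_psi_expOp_ketNeg {k : Type*} [Field k] [CharZero k] [Algebra k R]
    {c d : ℕ → R} {F G : R⟦X⟧} (hF0 : constantCoeff F = 1)
    (hF : derivative R F = derivative R (posSeries c) * F) (hG0 : constantCoeff G = 1)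
    (hG : derivative R G = derivative R (posSeries d) * G) {s : ℕ} (j : Fin s → ℤ) :
    braVacuum R (expOp k (currentSum c)
      ((List.ofFn fun i => psi R (j i) * expOp k (currentSum d)).prod (ketNeg R s))) =
    Matrix.det (Matrix.of fun i l : Fin s => coeffInt (j i + (l + 1)) (F * G ^ (i : ℕ))) := by
  simp only [← psiSeries_one]
  rw [ketNeg_eq, prod_psiSeries_mul_apply (expOp_currentSum_lowered d s)
    (expOp_psiSeries hG0 hG), apply_prod_psiSeries (expOp_currentSum_lowered c s)
    (expOp_psiSeries hF0 hF), braVacuum, Finsupp.lapply_apply, ← Maya.lowered_zero]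
  have := prod_psiSeries_apply_lowered 0 s j fun i => F * (G ^ (i : ℕ) * 1)
  rw [zero_add] at this
  simpa using this

end Products

/-! ## The generating series -/

section Series

open PowerSeries

theorem completeSymm_of_neg (k : Type*) [Field k] {n : ℤ} (hn : n < 0) : completeSymm k n = 0 := by
  refine Subtype.ext ?_
  funext d
  exact if_neg (by omega)

theorem completeSymm_zero (k : Type*) [Field k] : completeSymm k 0 = 1 := by
  classical
  refine Subtype.ext ?_
  change _ = (1 : MvPowerSeries ℕ k)
  ext d
  rw [MvPowerSeries.coeff_one]
  refine if_congr ?_ rfl rfl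
  rw [Nat.cast_eq_zero, Finsupp.degree_eq_zero_iff]

/-- A variable contributes exactly when its (a+1)-st power divides the monomial; the quotient has
degree b and so occurs once in h_b. -/
theorem coeff_powerSum_mul_completeSymm (k : Type*) [Field k] {a b : ℕ} {d : ℕ →₀ ℕ}
    (hd : d.degree = a + 1 + b) :
    MvPowerSeries.coeff d (R := k) ((powerSum k (a + 1)).1 * (completeSymm k b).1) =
      (d.support.filter fun i => a < d i).card := by
  classical
  rw [MvPowerSeries.coeff_mul, Finset.card_eq_sum_ones, Nat.cast_sum]
  symm
  have hs (i : ℕ) (hi : a < d i) : Finsupp.single i (a + 1) ≤ d := by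
    rw [Finsupp.single_le_iff]
    omega
  refine Finset.sum_of_injOn
    (fun i => (Finsupp.single i (a + 1), d - Finsupp.single i (a + 1))) ?_ ?_ ?_ ?_
  · intro i _ j _ h
    exact Finsupp.single_left_injective (Nat.succ_ne_zero a) (Prod.ext_iff.mp h).1
  · intro i hi
    simp only [Finset.coe_filter, Set.mem_ofPred_eq] at hi
    simpa using add_tsub_cancel_of_le (hs i hi.2)
  · rintro ⟨e, f⟩ hef hne
    rw [Finset.HasAntidiagonal.mem_antidiagonal] at hef
    simp only at hef
    have : MvPowerSeries.coeff e (R := k) (powerSum k (a + 1)).1 = 0 := by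
      refine if_neg ?_
      rintro ⟨i, rfl⟩
      refine hne ⟨i, ?_, ?_⟩
      · have : a < d i := by
          rw [← hef, Finsupp.add_apply, Finsupp.single_eq_same]
          omega
        simp only [Finset.coe_filter, Set.mem_ofPred_eq, Finsupp.mem_support_iff]
        omega
      · simp [← hef]
    rw [this, zero_mul]
  · intro i hi
    rw [Finset.mem_filter] at hi
    have h1 : MvPowerSeries.coeff (Finsupp.single i (a + 1)) (R := k) (powerSum k (a + 1)).1 = 1 :=
      if_pos ⟨i, rfl⟩
    have h2 : MvPowerSeries.coeff (d - Finsupp.single i (a + 1)) (R := k)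
        (completeSymm k b).1 = 1 := by
      refine if_pos ?_
      have := congrArg Finsupp.degree (add_tsub_cancel_of_le (hs i hi.2))
      rw [map_add, Finsupp.degree_single, hd] at this
      omega
    rw [h1, h2, mul_one, Nat.cast_one]

theorem coeff_powerSum_mul_completeSymm_of_ne (k : Type*) [Field k] {a b : ℕ} {d : ℕ →₀ ℕ}
    (hd : d.degree ≠ a + 1 + b) :
    MvPowerSeries.coeff d (R := k) ((powerSum k (a + 1)).1 * (completeSymm k b).1) = 0 := by
  classical
  rw [MvPowerSeries.coeff_mul]
  refine Finset.sum_eq_zero fun p hp => ?_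
  rw [Finset.HasAntidiagonal.mem_antidiagonal] at hp
  by_cases h : ∃ i, p.1 = Finsupp.single i (a + 1)
  · have : MvPowerSeries.coeff p.2 (R := k) (completeSymm k b).1 = 0 := by
      refine if_neg fun hb => hd ?_
      obtain ⟨i, hi⟩ := h
      rw [← hp, map_add, hi, Finsupp.degree_single]
      omega
    rw [this, mul_zero]
  · have : MvPowerSeries.coeff p.1 (R := k) (powerSum k (a + 1)).1 = 0 := if_neg h
    rw [this, zero_mul]

/-- Newton's identity for the complete symmetric functions. -/
theorem sum_powerSum_mul_completeSymm (k : Type*) [Field k] (n : ℕ) :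
    ∑ p ∈ Finset.HasAntidiagonal.antidiagonal n, powerSum k (p.1 + 1) * completeSymm k p.2 =
      ((n : SymFun k) + 1) * completeSymm k ((n : ℤ) + 1) := by
  classical
  have hval (x y : SymFun k) : (x * y).1 = x.1 * y.1 := rfl
  have hcast : (((n : SymFun k) + 1) * completeSymm k ((n : ℤ) + 1)).1 =
      (n + 1 : ℕ) • (completeSymm k ((n : ℤ) + 1)).1 := by
    rw [← Nat.cast_succ, ← nsmul_eq_mul]
    rfl
  refine Subtype.ext ?_
  rw [hcast]
  have hsum : (∑ p ∈ Finset.HasAntidiagonal.antidiagonal n,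
      powerSum k (p.1 + 1) * completeSymm k p.2).1 =
      ∑ p ∈ Finset.HasAntidiagonal.antidiagonal n,
        (powerSum k (p.1 + 1)).1 * (completeSymm k p.2).1 :=
    map_sum (symmetricFunctions k).val _ _
  rw [hsum]
  ext d
  rw [map_sum, map_nsmul]
  by_cases hd : d.degree = n + 1
  · have h1 : MvPowerSeries.coeff d (R := k) (completeSymm k ((n : ℤ) + 1)).1 = 1 :=
      if_pos (by rw [hd]; push_cast; rfl)
    rw [h1, Finset.sum_congr rfl fun p hp => coeff_powerSum_mul_completeSymm k (by
      rw [Finset.HasAntidiagonal.mem_antidiagonal] at hp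
      omega), ← Nat.cast_sum, nsmul_eq_mul, mul_one]
    congr 1
    rw [Finset.Nat.sum_antidiagonal_eq_sum_range_succ
      (fun a _ => (d.support.filter fun i => a < d i).card)]
    simp only [Finset.card_filter]
    -- After exchanging sums, variable i is counted once for each a < d i, so the total is the
    -- degree n + 1.
    rw [Finset.sum_comm, ← hd, Finsupp.degree]
    refine Finset.sum_congr rfl fun i hi => ?_
    have hle : d i ≤ n + 1 := hd ▸ Finsupp.le_degree i d
    rw [← Finset.card_filter]
    have : (Finset.range n.succ).filter (fun a => a < d i) = Finset.range (d i) := by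
      ext a
      simp only [Finset.mem_filter, Finset.mem_range]
      omega
    rw [this, Finset.card_range]
  · have h1 : MvPowerSeries.coeff d (R := k) (completeSymm k ((n : ℤ) + 1)).1 = 0 :=
      if_neg (by omega)
    rw [h1, smul_zero]
    refine Finset.sum_eq_zero fun p hp => coeff_powerSum_mul_completeSymm_of_ne k ?_
    rw [Finset.HasAntidiagonal.mem_antidiagonal] at hp
    omega

theorem derivative_posSeries {R : Type*} [CommRing R] (c : ℕ → R) :
    derivative R (posSeries c) = mk fun n => ((n : R) + 1) * c (n + 1) := by
  ext n
  rw [coeff_derivative, posSeries, coeff_succ_X_mul, coeff_mk, coeff_mk, mul_comm]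

/-- Newton's identity as a differential equation: differentiation cancels the denominators of p_n/n.
-/
theorem derivative_completeSymm (k : Type*) [Field k] [CharZero k] :
    derivative (SymFun k) (mk fun n : ℕ => completeSymm k n) =
      derivative (SymFun k) (posSeries fun n => (n : k)⁻¹ • powerSum k n) *
        mk fun n : ℕ => completeSymm k n := by
  rw [derivative_posSeries]
  ext n
  rw [coeff_derivative, coeff_mul, coeff_mk, mul_comm, Nat.cast_succ,
    ← sum_powerSum_mul_completeSymm]
  refine Finset.sum_congr rfl fun p _ => ?_
  rw [coeff_mk, coeff_mk]
  congr 1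
  have h : ((p.1 + 1 : ℕ) : k) ≠ 0 := Nat.cast_ne_zero.mpr (Nat.succ_ne_zero _)
  rw [← Nat.cast_succ, ← nsmul_eq_mul, ← Nat.cast_smul_eq_nsmul k, smul_smul, Nat.succ_eq_add_one,
    mul_inv_cancel₀ h, one_smul]

variable {R : Type*} [CommRing R]

theorem mk_neg_pow_mul (b : R) : (mk fun n => (-b) ^ n) * (1 + C b * X) = 1 := by
  ext n
  rw [mul_add, mul_one, mul_left_comm, map_add, coeff_C_mul, coeff_one, coeff_mk]
  cases n with
  | zero => simp
  | succ n =>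
    rw [coeff_succ_mul_X, coeff_mk, if_neg (Nat.succ_ne_zero n)]
    ring

theorem derivative_mk_neg_pow (b : R) :
    derivative R (mk fun n => (-b) ^ n) =
      -(C b * mk fun n => (-b) ^ n) * mk fun n => (-b) ^ n := by
  have h := mk_neg_pow_mul b
  have hD := congrArg (derivative R) h
  rw [Derivation.leibniz, derivative_one, map_add, derivative_one, zero_add, Derivation.leibniz,
    derivative_X, derivative_C] at hD
  simp only [smul_eq_mul, mul_one, mul_zero, add_zero] at hD
  linear_combination (mk fun n => (-b) ^ n) * hD - (derivative R (mk fun n => (-b) ^ n)) * h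

/-- For exponent -1 both series are inverse to 1 + bX; additivity of the binomial series in its
exponent gives the other powers. -/
theorem mk_neg_pow_pow (b : R) (i : ℕ) :
    (mk fun n => (-b) ^ n) ^ i = rescale b (binomialSeries R (-(i : ℤ))) := by
  have h1 : rescale b (binomialSeries R (-1 : ℤ)) = mk fun n => (-b) ^ n := by
    have h2 := binomialSeries_add (A := R) (-1 : ℤ) (1 : ℕ)
    rw [binomialSeries_nat, pow_one, Nat.cast_one, neg_add_cancel, binomialSeries_zero] at h2
    have h3 := congrArg (rescale b) h2
    rw [map_one, map_mul, map_add, map_one, rescale_X] at h3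
    have h4 := mk_neg_pow_mul b
    linear_combination (-(mk fun n => (-b) ^ n)) * h3 - (rescale b (binomialSeries R (-1 : ℤ))) * h4
  induction i with
  | zero => simp
  | succ i ih =>
    rw [pow_succ, ih, ← h1, ← map_mul, ← binomialSeries_add]
    congr 2
    push_cast
    ring

/-- The series under `posSeries` is -log(1 + βX), with derivative -β/(1 + βX). -/
theorem derivative_mk_neg_pow_eq {k : Type*} [Field k] [CharZero k] [Algebra k R] (β : k) :
    derivative R (mk fun n => (-algebraMap k R β) ^ n) =
      derivative R (posSeries fun n => -algebraMap k R ((-1) ^ (n - 1) * β ^ n / n)) *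
        mk fun n => (-algebraMap k R β) ^ n := by
  rw [derivative_mk_neg_pow, derivative_posSeries]
  congr 1
  ext n
  have h : ((n + 1 : ℕ) : k) ≠ 0 := Nat.cast_ne_zero.mpr (Nat.succ_ne_zero _)
  rw [map_neg, coeff_C_mul, coeff_mk, coeff_mk, Nat.add_sub_cancel, mul_neg, ← map_neg, ← map_pow,
    ← map_mul, ← Nat.cast_succ, ← map_natCast (algebraMap k R), ← map_mul, Nat.succ_eq_add_one,
    mul_div_cancel₀ _ h]
  congr 2
  ring

end Series

/-! ### Matrix entries as coefficients, and the determinant formula. -/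

section Main

open PowerSeries

theorem finsum_choose_smul_completeSymm {k : Type*} [Field k] (β : k) (i : ℕ) (n : ℤ) :
    ∑ᶠ m : ℕ, (((Ring.choose (-(i : ℤ)) m : ℤ) : k) * β ^ m) • completeSymm k (n - (m : ℤ)) =
      coeffInt n ((mk fun n : ℕ => completeSymm k n) *
        (mk fun n => (-algebraMap k (SymFun k) β) ^ n) ^ i) := by
  rcases lt_or_ge n 0 with hn | hn
  · rw [coeffInt_of_neg hn]
    refine finsum_eq_zero_of_forall_eq_zero fun m => ?_
    rw [completeSymm_of_neg k (by omega), smul_zero]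
  lift n to ℕ using hn
  rw [coeffInt_natCast, mk_neg_pow_pow, mul_comm, coeff_mul,
    Finset.Nat.sum_antidiagonal_eq_sum_range_succ_mk,
    finsum_eq_sum_of_support_subset (s := Finset.range n.succ)]
  · refine Finset.sum_congr rfl fun m hm => ?_
    rw [Finset.mem_range] at hm
    rw [coeff_rescale, binomialSeries_coeff, coeff_mk, Nat.cast_sub (by omega), Algebra.smul_def,
      map_mul, map_pow, map_intCast, zsmul_eq_mul, mul_one]
    congr 1
    ring
  -- Terms with m > n vanish because the index of the complete symmetric function is negative.
  · intro m hm
    by_contra h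
    simp only [Finset.coe_range, Set.mem_Iio, not_lt] at h
    exact hm (by simp only; rw [completeSymm_of_neg k (by omega), smul_zero])

end Main

theorem mainTheorem5 {k : Type*} [Field k] [CharZero k] (β : k) (lam : YoungDiagram)
    (s : ℕ) (hs : lam.colLen 0 ≤ s) (r : ℕ) (hr : lam.colLen 0 ≤ r) :
    dualGrothendieck β lam s =
      Matrix.det (Matrix.of fun i j : Fin r =>
        ∑ᶠ m : ℕ, (((Ring.choose (1 - ((i : ℤ) + 1)) m : ℤ) : k) * β ^ m) •
          completeSymm k ((lam.rowLen i : ℤ) - ((i : ℤ) + 1) + ((j : ℤ) + 1) - (m : ℤ))) := by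
  have hsub (i : ℕ) : 1 - ((i : ℤ) + 1) = -(i : ℤ) := by ring
  simp only [hsub, finsum_choose_smul_completeSymm]
  set F : PowerSeries (SymFun k) := PowerSeries.mk fun n : ℕ => completeSymm k n
  set G : PowerSeries (SymFun k) := PowerSeries.mk fun n => (-algebraMap k (SymFun k) β) ^ n
  have hF0 : PowerSeries.constantCoeff F = 1 := by
    rw [← PowerSeries.coeff_zero_eq_constantCoeff_apply, PowerSeries.coeff_mk, Nat.cast_zero,
      completeSymm_zero]
  have hG0 : PowerSeries.constantCoeff G = 1 := by
    rw [← PowerSeries.coeff_zero_eq_constantCoeff_apply, PowerSeries.coeff_mk, pow_zero]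
  have hrow (i : ℕ) (hi : lam.colLen 0 ≤ i) : lam.rowLen i = 0 := by
    by_contra h
    have h1 : (i, 0) ∈ lam := YoungDiagram.mem_iff_lt_rowLen.mpr (Nat.pos_of_ne_zero h)
    have := YoungDiagram.mem_iff_lt_colLen.mp h1
    omega
  -- Beyond the length of the partition, entry (i, j) is the coefficient of X^(j-i) in F Gⁱ, whose
  -- constant term is 1.
  have hdet (r : ℕ) (hr : lam.colLen 0 ≤ r) := det_eq_of_unitriangular_rows hr
    (fun i j => coeffInt ((lam.rowLen i : ℤ) - ((i : ℤ) + 1) + ((j : ℤ) + 1)) (F * G ^ i))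
    (fun i j hi hj => coeffInt_of_neg (by rw [hrow i hi]; push_cast; omega) _)
    (fun i hi => by
      rw [hrow i hi, show ((0 : ℕ) : ℤ) - ((i : ℤ) + 1) + ((i : ℤ) + 1) = (0 : ℕ) by ring,
        coeffInt_natCast, PowerSeries.coeff_zero_eq_constantCoeff_apply, map_mul, map_pow, hF0,
        hG0, one_pow, one_mul])
  rw [hdet r hr, ← hdet s hs, dualGrothendieck, opH, opTheta, currentSum_neg]
  exact bra_expOp_prod_psi_expOp_ketNeg hF0 (derivative_completeSymm k) hG0
    (derivative_mk_neg_pow_eq β) _
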